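/- Let $q$ be a prime, let $\mathcal X_1,\mathcal X_2,\mathcal Y$ be finite sets and let $P_{Y|X_1X_2}$ be a two-user discrete memoryless multiple-access channel. All logarithms are to base 2, $\mathcal U=\{0,\dots,q-1\}$ (identified with $\mathbb F_q$), and $\mathcal W=\{0,\dots,2q-2\}$. A computation code of block length $n$ with message sets $\mathcal M,\mathcal N$ consists of injective codeword assignments $\mathbf t:\mathcal M\to\mathcal U^n$ and $\mathbf v:\mathcal N\to\mathcal U^n$, encoding maps $\mathcal U^n\to\mathcal X_1^n$ and $\mathcal U^n\to\mathcal X_2^n$ from codewords to channel inputs, and a decoder $\mathcal Y^n\to\mathcal W^n$. Its average error probability $P_e^{(n)}$ is the probability, for independent uniformly distributed messages $m,n'$, that the decoder output differs from the entrywise integer sum $\mathbf t(m)+\mathbf v(n')$. A pair $(R_1,R_2)$ is achievable if there are computation codes, one for each block length $n$, with $\lceil 2^{nR_1}\rceil$ and $\lceil 2^{nR_2}\rceil$ messages and $P_e^{(n)}\to0$. Let $P_{X_1|U}$ and $P_{X_2|U}$ be arbitrary conditional distributions from $\mathcal U$ to $\mathcal X_1$ and to $\mathcal X_2$. Let $U_1,U_2$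 be independent and uniform on $\mathcal U$, and let $$P_{U_1U_2Y}(u_1,u_2,y)=\sum_{x_1,x_2}\tfrac1{q^2}P_{X_1|U}(x_1|u_1)P_{X_2|U}(x_2|u_2)P_{Y|X_1X_2}(y|x_1,x_2).$$ Let $D(q)=H(U_1+U_2)-\log q$, where $U_1+U_2$ is the integer sum. If $$\max\{R_1,R_2\}<I(U_1+U_2;Y)-D(q),$$ then $(R_1,R_2)$ is achievable. Moreover, with $k_j=\max\{0,\lfloor nR_j/\log q\rfloor\}$ there are computation codes with message sets $\mathbb F_q^{k_1},\mathbb F_q^{k_2}$ and $P_e^{(n)}\to0$ whose codebooks are nested linear codes with dithers: $\mathbf t(m)=\mathbf G[m;\mathbf 0]\oplus \mathbf d_1$ and $\mathbf v(n')=\mathbf G[n';\mathbf 0]\oplus\mathbf d_2$, with a common generator matrix $\mathbf G\in\mathbb F_q^{n\times\max\{k_1,k_2\}}$ of full column rank and $\mathbf d_1,\mathbf d_2\in\mathbb F_q^n$, the messages being padded with zeros to length $\max\{k_1,k_2\}$. -/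

import Mathlib

open Filter Topology

noncomputable section

namespace SumMAC

/-- Shannon entropy, in bits, of a probability mass function on a finite set. -/
def entropy {α : Type*} [Fintype α] (p : α → ℝ) : ℝ :=
  -∑ a, p a * Real.logb 2 (p a)

/-- Mutual information `I(A;B) = H(A) + H(B) - H(A,B)`, in bits, of a joint probability mass
function on a product of two finite sets. -/
def mutualInfo {α β : Type*} [Fintype α] [Fintype β] (p : α → β → ℝ) : ℝ :=
  entropy (fun a => ∑ b, p a b) + entropy (fun b => ∑ a, p a b)
    - entropy (fun ab : α × β => p ab.1 ab.2)

/-- The uniform distribution on `{0, …, q-1}`. This set is represented by `ZMod q`, an element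
`u` standing for the integer `u.val`. -/
def PU (q : ℕ) (_u : ZMod q) : ℝ := 1 / q

section Channel

variable (q : ℕ) [NeZero q]

/-- The distribution on `{0, …, 2q-2}` of the integer sum `U₁ + U₂` of two independent
variables that are uniform on `{0, …, q-1}`. -/
def PW (w : Fin (2 * q - 1)) : ℝ :=
  ∑ u₁ : ZMod q, ∑ u₂ : ZMod q, if u₁.val + u₂.val = (w : ℕ) then PU q u₁ * PU q u₂ else 0

/-- `D(q) = H(U₁ + U₂) - log q`. -/
def D : ℝ := entropy (PW q) - Real.logb 2 q

variable {X₁ X₂ Y : Type*} [Fintype X₁] [Fintype X₂]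

/-- The joint distribution of `(U₁, U₂, Y)` when `U₁, U₂` are independent and uniform, `X_j` is
generated from `U_j` by `V_j`, and `Y` from `(X₁, X₂)` by the channel `P`. -/
def PUUY (V₁ : ZMod q → PMF X₁) (V₂ : ZMod q → PMF X₂) (P : X₁ → X₂ → PMF Y)
    (u₁ u₂ : ZMod q) (y : Y) : ℝ :=
  ∑ x₁, ∑ x₂, PU q u₁ * PU q u₂ * (V₁ u₁ x₁).toReal * (V₂ u₂ x₂).toReal * (P x₁ x₂ y).toReal

/-- The joint distribution of `(U₁ + U₂, Y)`, with the sum taken in the integers. -/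
def PWY (V₁ : ZMod q → PMF X₁) (V₂ : ZMod q → PMF X₂) (P : X₁ → X₂ → PMF Y)
    (w : Fin (2 * q - 1)) (y : Y) : ℝ :=
  ∑ u₁ : ZMod q, ∑ u₂ : ZMod q,
    if u₁.val + u₂.val = (w : ℕ) then PUUY q V₁ V₂ P u₁ u₂ y else 0

end Channel

/-- A computation code of block length `n` over `{0, …, q-1}`, with message sets `M` and `N`:
each user assigns to every message its own codeword (distinct messages get distinct codewords)
and maps the codeword to a channel input sequence; the decoder maps a channel output sequence
to an estimate of the integer sum of the two codewords. -/
structure ComputationCode (q : ℕ) (X₁ X₂ Y : Type*) (M N : Type*) (n : ℕ) where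
  /-- codewords of user 1 -/
  t : M → Fin n → ZMod q
  /-- codewords of user 2 -/
  v : N → Fin n → ZMod q
  t_injective : Function.Injective t
  v_injective : Function.Injective v
  /-- channel input sequence of user 1 for a given codeword -/
  enc₁ : (Fin n → ZMod q) → Fin n → X₁
  /-- channel input sequence of user 2 for a given codeword -/
  enc₂ : (Fin n → ZMod q) → Fin n → X₂
  /-- estimate of the sum -/
  dec : (Fin n → Y) → Fin n → Fin (2 * q - 1)

namespace ComputationCode

variable {q n : ℕ} {X₁ X₂ Y M N : Type*} [Fintype Y]

/-- The conditional probability, given the messages `a` and `b`, that over `n` uses of the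
memoryless channel `P` the decoder does not output the integer sum of the two codewords. -/
def condError (c : ComputationCode q X₁ X₂ Y M N n) (P : X₁ → X₂ → PMF Y)
    (a : M) (b : N) : ℝ :=
  ∑ y : Fin n → Y,
    if ∀ i, (c.dec y i : ℕ) = (c.t a i).val + (c.v b i).val then 0
    else ∏ i, (P (c.enc₁ (c.t a) i) (c.enc₂ (c.v b) i) (y i)).toReal

/-- The average sum-decoding error probability, for independent uniform messages. -/
def avgError [Fintype M] [Fintype N] (c : ComputationCode q X₁ X₂ Y M N n)
    (P : X₁ → X₂ → PMF Y) : ℝ :=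
  ∑ a : M, ∑ b : N, 1 / (Fintype.card M : ℝ) * (1 / (Fintype.card N : ℝ)) * c.condError P a b

end ComputationCode

/-- The rate pair `(R₁, R₂)` is achievable: there are computation codes with `2 ^ (n R₁)` and
`2 ^ (n R₂)` messages (rounded up to integers) whose average error probability tends to `0`. -/
def IsAchievable (q : ℕ) {X₁ X₂ Y : Type*} [Fintype Y] (P : X₁ → X₂ → PMF Y)
    (R₁ R₂ : ℝ) : Prop :=
  ∃ c : ∀ n : ℕ, ComputationCode q X₁ X₂ Y
      (Fin ⌈(2 : ℝ) ^ (n * R₁)⌉₊) (Fin ⌈(2 : ℝ) ^ (n * R₂)⌉₊) n,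
    Tendsto (fun n => (c n).avgError P) atTop (𝓝 0)

/-- Append zeros to a vector of length `k` (used for `k ≤ l`). -/
def zeroPad {q k : ℕ} (l : ℕ) (m : Fin k → ZMod q) : Fin l → ZMod q :=
  fun i => if h : (i : ℕ) < k then m ⟨i, h⟩ else 0

/-- The codebooks are nested linear codes of dimensions `k₁`, `k₂`, shifted by dithers: there
are a common generator matrix `G` of full column rank and vectors `d₁`, `d₂` such that message
`m` has codeword `G m ⊕ d_j`, the shorter of the two messages being padded with zeros. -/
def ComputationCode.IsNestedLinear {q n k₁ k₂ : ℕ} {X₁ X₂ Y : Type*}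
    (c : ComputationCode q X₁ X₂ Y (Fin k₁ → ZMod q) (Fin k₂ → ZMod q) n) : Prop :=
  ∃ (G : Matrix (Fin n) (Fin (max k₁ k₂)) (ZMod q)) (d₁ d₂ : Fin n → ZMod q),
    Function.Injective G.mulVec ∧
    (∀ m, c.t m = G.mulVec (zeroPad (max k₁ k₂) m) + d₁) ∧
    (∀ m, c.v m = G.mulVec (zeroPad (max k₁ k₂) m) + d₂)

/-- The rate pair `(R₁, R₂)` is achieved by nested linear codes with dithers, of dimensions
`k_j = ⌊n R_j / log q⌋`. -/
def IsAchievableByNestedLinear (q : ℕ) [NeZero q] {X₁ X₂ Y : Type*} [Fintype Y]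
    (P : X₁ → X₂ → PMF Y) (R₁ R₂ : ℝ) : Prop :=
  ∃ c : ∀ n : ℕ, ComputationCode q X₁ X₂ Y
      (Fin ⌊n * R₁ / Real.logb 2 q⌋₊ → ZMod q) (Fin ⌊n * R₂ / Real.logb 2 q⌋₊ → ZMod q) n,
    (∀ n, (c n).IsNestedLinear) ∧ Tendsto (fun n => (c n).avgError P) atTop (𝓝 0)

end SumMAC

end

/-! The encoders may be arbitrary functions of the whole codeword, so the codebooks can be trivial.
With `n = k + m`, a codeword is a dithered message in the first `k` symbols followed by `m` zeros,
and its generator matrix is an identity block over a zero block. The actual coding happens in the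
encoders, which extend the first `k` symbols `u` to a sequence of length `n` with prescribed
syndrome `d`, then apply letterwise maps to the channel alphabet.

The syndrome is the base-`q` value of the last `m` entries minus a random linear form `A` in the
first `k`, modulo `q ^ m`. It is computed on integers, so it is additive for integer sums with
carries (`syndrome_add`): the decoder knows that the sum has syndrome `d₁ + d₂`. Hashing over the
field would not do, since entries of two candidate sums may differ by exactly `q`. Modulo `q ^ m`, a
nonzero difference smaller than `2q` in absolute value annihilates at most `q` residues, so two
candidates that differ in the first `k` entries collide with probability at most `q / q ^ m`
(`card_filter_syndrome_eq_le`).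

Uniform dithers make the two extended sequences independent and uniform (`sum_extend`), and random
letterwise maps reproduce the test channels (`sum_strategyWeight_mul`). For `W = U₁ + U₂` and `τ >
H(W|Y)`, at most `2 ^ (nτ)` sums are likely given the output, and the true sum is unlikely with
exponentially small probability. The error is thus at most an exponentially small term plus `q 2 ^
(nτ) / q ^ m`. Since `q ^ k` is about `2 ^ (nR)`, this vanishes if `R + τ < log q`, and `log q -
H(W|Y) = I(W;Y) - D(q)` (`mutualInfo_sub_D`). -/

namespace SumMAC

/-! ### Linear hashing of integer vectors modulo a prime power -/

section Hash

/-- The residue modulo `q ^ m` of the integer with base-`q` digits `s`, which need not be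
reduced. -/
def digitValue (q m : ℕ) (s : Fin m → ℕ) : ZMod (q ^ m) :=
  ((∑ i, s i * q ^ (i : ℕ) : ℕ) : ZMod (q ^ m))

lemma digitValue_add {q : ℕ} (m : ℕ) (s s' : Fin m → ℕ) :
    digitValue q m (s + s') = digitValue q m s + digitValue q m s' := by
  simp only [digitValue, Pi.add_apply, add_mul, Finset.sum_add_distrib, Nat.cast_add]

variable {q : ℕ} [Fact q.Prime]

/-- Uniqueness of base-`q` expansions below `q ^ m`, combined with a cardinality count. It lets any
syndrome be realised by exactly one choice of the last `m` symbols. -/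
lemma digitValue_val_bijective (m : ℕ) :
    Function.Bijective (fun c : Fin m → ZMod q => digitValue q m (fun i => (c i).val)) := by
  rw [Fintype.bijective_iff_injective_and_card]
  refine ⟨fun c c' h => ?_, by simp [ZMod.card]⟩
  have key (c : Fin m → ZMod q) : ∑ i, (c i).val * q ^ (i : ℕ) =
      (finFunctionFinEquiv (fun i => (⟨(c i).val, ZMod.val_lt (c i)⟩ : Fin q)) : ℕ) := by
    rw [finFunctionFinEquiv_apply]
  simp only [digitValue] at h
  rw [ZMod.natCast_eq_natCast_iff, key, key] at h
  have h2 := Nat.ModEq.eq_of_lt_of_lt h (Fin.is_lt _) (Fin.is_lt _)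
  have h3 := finFunctionFinEquiv.injective (Fin.ext h2)
  funext i
  have h4 := congrFun h3 i
  exact ZMod.val_injective q (by simpa using h4)

lemma card_filter_mul_prime_eq_zero_le (m : ℕ) :
    (Finset.univ.filter fun b : ZMod (q ^ m) => b * (q : ZMod (q ^ m)) = 0).card ≤ q := by
  classical
  have hq : q.Prime := Fact.out
  cases m with
  | zero =>
    refine (Finset.card_le_univ _).trans ?_
    simpa [ZMod.card] using hq.one_lt.le
  | succ m =>
    have hsub : (Finset.univ.filter fun b : ZMod (q ^ (m + 1)) => b * (q : ZMod (q ^ (m + 1))) = 0)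
        ⊆ (Finset.range q).image (fun j => ((q ^ m * j : ℕ) : ZMod (q ^ (m + 1)))) := by
      intro b hb
      rw [Finset.mem_filter] at hb
      have hb2 : ((b.val * q : ℕ) : ZMod (q ^ (m + 1))) = 0 := by
        rw [Nat.cast_mul, ZMod.natCast_zmod_val]; exact hb.2
      obtain ⟨j, hj⟩ := Nat.dvd_of_mul_dvd_mul_right hq.pos
        ((dvd_of_eq (pow_succ q m).symm).trans ((ZMod.natCast_eq_zero_iff _ _).mp hb2))
      rw [Finset.mem_image]
      refine ⟨j, ?_, by rw [← hj, ZMod.natCast_zmod_val]⟩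
      rw [Finset.mem_range]
      have := (ZMod.val_lt b).trans_eq (pow_succ q m)
      rw [hj] at this
      exact lt_of_mul_lt_mul_left this (Nat.zero_le _)
    exact (Finset.card_le_card hsub).trans (Finset.card_image_le.trans (by simp))

/-- The only nonzero multiples of `q` in this range are `±q`; any other `δ` is coprime to `q`, hence
a unit modulo `q ^ m`. -/
lemma mul_prime_eq_zero_of_mul_intCast_eq_zero (m : ℕ) {δ : ℤ} (h0 : δ ≠ 0) (h1 : |δ| < 2 * q)
    {b : ZMod (q ^ m)} (hb : b * (δ : ZMod (q ^ m)) = 0) : b * (q : ZMod (q ^ m)) = 0 := by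
  have hq : q.Prime := Fact.out
  by_cases hd : (q : ℤ) ∣ δ
  · obtain ⟨c, rfl⟩ := hd
    have hc : |c| < 2 := by
      rw [abs_mul, Nat.abs_cast, mul_comm] at h1
      exact lt_of_mul_lt_mul_right h1 (by positivity)
    have hc0 : c ≠ 0 := right_ne_zero_of_mul h0
    rw [abs_lt] at hc
    have : c = 1 ∨ c = -1 := by omega
    rcases this with rfl | rfl
    · simpa using hb
    · simpa using hb
  · have hcop : IsCoprime δ ((q ^ m : ℕ) : ℤ) := by
      push_cast
      exact (((Nat.prime_iff_prime_int.mp hq).coprime_iff_not_dvd.mpr hd).symm).pow_right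
    have hu : IsUnit ((δ : ℤ) : ZMod (q ^ m)) := by
      obtain ⟨x, y, hxy⟩ := hcop
      refine IsUnit.of_mul_eq_one (x : ZMod (q ^ m)) ?_
      have := congrArg (Int.cast : ℤ → ZMod (q ^ m)) hxy
      rw [Int.cast_add, Int.cast_mul, Int.cast_mul, Int.cast_natCast, ZMod.natCast_self, mul_zero,
        add_zero, Int.cast_one, mul_comm] at this
      exact this
    rw [hu.mul_left_eq_zero.mp hb, zero_mul]

lemma card_filter_mul_intCast_eq_le (m : ℕ) {δ : ℤ} (h0 : δ ≠ 0) (h1 : |δ| < 2 * q)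
    (g : ZMod (q ^ m)) :
    (Finset.univ.filter fun b : ZMod (q ^ m) => b * (δ : ZMod (q ^ m)) = g).card ≤ q := by
  classical
  rcases (Finset.univ.filter fun b : ZMod (q ^ m) => b * (δ : ZMod (q ^ m)) = g).eq_empty_or_nonempty
    with he | ⟨a, ha⟩
  · rw [he]; simp
  · rw [Finset.mem_filter] at ha
    -- Subtracting one solution `a` moves the solution set into the annihilator of `q`.
    refine le_trans ?_ (card_filter_mul_prime_eq_zero_le m)
    refine Finset.card_le_card_of_injOn (fun b => b - a) (fun b hb => ?_)
      (fun b _ b' _ h => sub_left_injective h)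
    simp only [Finset.coe_filter, Finset.mem_univ, true_and, Set.mem_ofPred_eq] at hb ⊢
    exact mul_prime_eq_zero_of_mul_intCast_eq_zero m h0 h1 (by rw [sub_mul, hb, ha.2, sub_self])

/-- A random linear form modulo `q ^ m` takes each value with probability at most `q / q ^ m` on
a fixed nonzero integer vector with entries less than `2 q` in absolute value. -/
lemma card_filter_linearForm_eq_le (k m : ℕ) {δ : Fin k → ℤ} (h0 : δ ≠ 0)
    (h1 : ∀ i, |δ i| < 2 * q) (g : ZMod (q ^ m)) :
    (Finset.univ.filter fun A : Fin k → ZMod (q ^ m) =>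
      ∑ i, A i * (δ i : ZMod (q ^ m)) = g).card * q ^ m ≤ q * (q ^ m) ^ k := by
  classical
  obtain ⟨i₀, hi₀⟩ := Function.ne_iff.mp h0
  set S := Finset.univ.filter fun A : Fin k → ZMod (q ^ m) =>
      ∑ i, A i * (δ i : ZMod (q ^ m)) = g with hS
  have hcard : S.card * q ^ m = (S ×ˢ (Finset.univ : Finset (ZMod (q ^ m)))).card := by
    rw [Finset.card_product, Finset.card_univ, ZMod.card]
  have huniv : (q ^ m) ^ k = (Finset.univ : Finset (Fin k → ZMod (q ^ m))).card := by
    simp [ZMod.card]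
  rw [hcard, huniv]
  -- Double counting: shift each solution `A` by every `b` in a coordinate where `δ` is nonzero. In
  -- the fibre over `B`, the shift satisfies `b * δ i₀ = B · δ - g`, which has at most `q`
  -- solutions, and `b` determines `A`.
  refine Finset.card_le_mul_card_image_of_maps_to
    (f := fun x : (Fin k → ZMod (q ^ m)) × ZMod (q ^ m) => x.1 + Pi.single i₀ x.2)
    (fun _ _ => Finset.mem_univ _) _ (fun B _ => ?_)
  refine le_trans ?_ (card_filter_mul_intCast_eq_le m hi₀ (h1 i₀)
    (∑ i, B i * (δ i : ZMod (q ^ m)) - g))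
  refine Finset.card_le_card_of_injOn Prod.snd ?_ ?_
  · rintro ⟨A, b⟩ hx
    simp only [hS, Finset.coe_filter, Finset.mem_product, Finset.mem_filter, Finset.mem_univ,
      true_and, and_true, Set.mem_ofPred_eq] at hx ⊢
    rw [← hx.2, ← hx.1, ← Finset.sum_sub_distrib]
    simp only [Pi.add_apply, add_mul, add_sub_cancel_left]
    rw [Finset.sum_eq_single i₀ (fun j _ hj => by simp [hj]) (by simp)]
    simp
  · rintro ⟨A, b⟩ hx ⟨A', b'⟩ hx' hb
    simp only [Finset.coe_filter, Set.mem_ofPred_eq] at hx hx' hb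
    subst hb
    have := hx.2.trans hx'.2.symm
    simpa using this

end Hash

lemma sum_prod_eq_prod_sum {ι α : Type*} [Fintype ι] [DecidableEq ι] [Fintype α]
    (g : ι → α → ℝ) : ∑ f : ι → α, ∏ i, g i (f i) = ∏ i, ∑ a, g i a := by
  classical
  rw [Finset.prod_univ_sum, Fintype.piFinset_univ]

/-! ### Syndrome coding and its error averaged over hash and dithers -/

section RandomCoding

variable {q : ℕ}

/-- The integer sum of two elements of `{0, …, q-1}`. -/
def intSum [NeZero q] (u₁ u₂ : ZMod q) : Fin (2 * q - 1) :=
  ⟨u₁.val + u₂.val, by have := ZMod.val_lt u₁; have := ZMod.val_lt u₂; omega⟩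

/-- The residue modulo `q ^ m` by which the last `m` entries of `s`, read as base-`q` digits,
exceed the linear form `A` in the first `k` entries. -/
def syndrome {k m : ℕ} (A : Fin k → ZMod (q ^ m)) (s : Fin (k + m) → ℕ) : ZMod (q ^ m) :=
  digitValue q m (fun i => s (Fin.natAdd k i)) - ∑ i, A i * (s (Fin.castAdd m i) : ZMod (q ^ m))

lemma syndrome_add {k m : ℕ} (A : Fin k → ZMod (q ^ m)) (s s' : Fin (k + m) → ℕ) :
    syndrome A (fun i => s i + s' i) = syndrome A s + syndrome A s' := by
  have := digitValue_add (q := q) m (fun i => s (Fin.natAdd k i)) (fun i => s' (Fin.natAdd k i))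
  simp only [syndrome, Nat.cast_add, mul_add, Finset.sum_add_distrib]
  rw [show (fun i => s (Fin.natAdd k i) + s' (Fin.natAdd k i)) =
    (fun i => s (Fin.natAdd k i)) + (fun i => s' (Fin.natAdd k i)) from rfl, this]
  ring

variable [Fact q.Prime]

/-- Splitting off the first `k` symbols and the syndrome determines a sequence. -/
noncomputable def splitEquiv {k m : ℕ} (A : Fin k → ZMod (q ^ m)) :
    (Fin (k + m) → ZMod q) ≃ (Fin k → ZMod q) × ZMod (q ^ m) :=
  (Fin.appendEquiv k m).symm.trans
    ((Equiv.prodCongrRight fun u : Fin k → ZMod q =>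
      (Equiv.ofBijective _ (digitValue_val_bijective (q := q) m)).trans
        (Equiv.subRight (∑ i, A i * ((u i).val : ZMod (q ^ m))))))

lemma splitEquiv_apply {k m : ℕ} (A : Fin k → ZMod (q ^ m)) (U : Fin (k + m) → ZMod q) :
    splitEquiv A U = (fun i => U (Fin.castAdd m i), syndrome A (fun i => (U i).val)) := rfl

/-- The sequence with given first `k` symbols and given syndrome. -/
noncomputable def extend {k m : ℕ} (A : Fin k → ZMod (q ^ m)) (d : ZMod (q ^ m))
    (u : Fin k → ZMod q) : Fin (k + m) → ZMod q :=
  (splitEquiv A).symm (u, d)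

/-- Change of variables along `splitEquiv`: a uniform prefix and a uniform syndrome give a uniform
sequence, whatever `A` is. -/
lemma sum_extend {k m : ℕ} (A : Fin k → ZMod (q ^ m))
    (F : (Fin k → ZMod q) → ZMod (q ^ m) → (Fin (k + m) → ZMod q) → ℝ) :
    ∑ d, ∑ u, F u d (extend A d u) =
      ∑ U, F (fun i => U (Fin.castAdd m i)) (syndrome A (fun i => (U i).val)) U := by
  rw [Finset.sum_comm, ← Fintype.sum_prod_type'
    (f := fun u d => F u d (extend A d u)), ← (splitEquiv A).sum_comp]
  refine Finset.sum_congr rfl fun U _ => ?_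
  simp only [extend, splitEquiv_apply]
  rw [← splitEquiv_apply, Equiv.symm_apply_apply]

variable {Y : Type*}

open Classical in
/-- The decoder looks for a sequence `w` that satisfies the test `T` together with the channel
output and has the right syndrome, and outputs its first `k` symbols. -/
noncomputable def syndromeDecoder {k m : ℕ}
    (T : (Fin (k + m) → Fin (2 * q - 1)) → (Fin (k + m) → Y) → Prop)
    (A : Fin k → ZMod (q ^ m)) (d : ZMod (q ^ m)) (y : Fin (k + m) → Y) :
    Fin k → Fin (2 * q - 1) :=
  if h : ∃ w, T w y ∧ syndrome A (fun i => (w i : ℕ)) = d then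
    fun i => h.choose (Fin.castAdd m i)
  else fun _ => intSum 0 0

lemma exists_of_syndromeDecoder_ne {k m : ℕ}
    {T : (Fin (k + m) → Fin (2 * q - 1)) → (Fin (k + m) → Y) → Prop}
    {A : Fin k → ZMod (q ^ m)} {y : Fin (k + m) → Y} {w : Fin (k + m) → Fin (2 * q - 1)}
    (hT : T w y)
    (hne : syndromeDecoder T A (syndrome A (fun i => (w i : ℕ))) y ≠
      fun i => w (Fin.castAdd m i)) :
    ∃ w', T w' y ∧ (∃ i, w' (Fin.castAdd m i) ≠ w (Fin.castAdd m i)) ∧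
      syndrome A (fun i => (w' i : ℕ)) = syndrome A (fun i => (w i : ℕ)) := by
  have h : ∃ w', T w' y ∧ syndrome A (fun i => (w' i : ℕ)) = syndrome A (fun i => (w i : ℕ)) :=
    ⟨w, hT, rfl⟩
  rw [syndromeDecoder, dif_pos h] at hne
  exact ⟨h.choose, h.choose_spec.1, Function.ne_iff.mp hne, h.choose_spec.2⟩

/-- Equality of the syndromes is one inhomogeneous linear equation in `A`, with coefficients the
differences of the first `k` entries; these are at most `2q - 2` in absolute value. -/
lemma card_filter_syndrome_eq_le {k m : ℕ} (w w' : Fin (k + m) → Fin (2 * q - 1))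
    (hne : ∃ i, w' (Fin.castAdd m i) ≠ w (Fin.castAdd m i)) :
    (Finset.univ.filter fun A : Fin k → ZMod (q ^ m) =>
      syndrome A (fun i => (w' i : ℕ)) = syndrome A (fun i => (w i : ℕ))).card * q ^ m
      ≤ q * (q ^ m) ^ k := by
  classical
  have hq : q.Prime := Fact.out
  obtain ⟨i₀, hi₀⟩ := hne
  refine le_trans (Nat.mul_le_mul_right _ (Finset.card_le_card ?_))
    (card_filter_linearForm_eq_le k m
      (δ := fun i => ((w' (Fin.castAdd m i) : ℕ) : ℤ) - ((w (Fin.castAdd m i) : ℕ) : ℤ)) ?_ ?_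
      (digitValue q m (fun i => (w' (Fin.natAdd k i) : ℕ)) -
        digitValue q m (fun i => (w (Fin.natAdd k i) : ℕ))))
  · intro A hA
    simp only [Finset.mem_filter, Finset.mem_univ, true_and, syndrome] at hA ⊢
    simp only [Int.cast_sub, Int.cast_natCast, mul_sub, Finset.sum_sub_distrib]
    linear_combination -hA
  · refine Function.ne_iff.mpr ⟨i₀, fun h => hi₀ (Fin.ext ?_)⟩
    simp only [Pi.zero_apply] at h
    omega
  · intro i
    have h1 := (w' (Fin.castAdd m i)).is_lt
    have h2 := (w (Fin.castAdd m i)).is_lt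
    rw [abs_lt]
    constructor <;> omega

open Classical in
-- Union bound over the at most `L` sequences passing the test. Competitors that agree with `w` on
-- the first `k` symbols do no harm, because only those symbols are output.
lemma sum_syndromeDecoder_ne_le {k m : ℕ}
    (T : (Fin (k + m) → Fin (2 * q - 1)) → (Fin (k + m) → Y) → Prop) {L : ℝ}
    (hL : ∀ y, ((Finset.univ.filter fun w => T w y).card : ℝ) ≤ L)
    (w : Fin (k + m) → Fin (2 * q - 1)) (y : Fin (k + m) → Y) :
    ∑ A : Fin k → ZMod (q ^ m),
      (if syndromeDecoder T A (syndrome A (fun i => (w i : ℕ))) y = fun i => w (Fin.castAdd m i)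
        then (0 : ℝ) else 1)
      ≤ ((q : ℝ) ^ m) ^ k * ((if T w y then 0 else 1) + q * L / (q : ℝ) ^ m) := by
  have hq : (0 : ℝ) < q := by exact_mod_cast (Fact.out : q.Prime).pos
  have hL0 : 0 ≤ L := (Nat.cast_nonneg _).trans (hL y)
  have hcard : ((Finset.univ : Finset (Fin k → ZMod (q ^ m))).card : ℝ) = ((q : ℝ) ^ m) ^ k := by
    simp [ZMod.card]
  by_cases hT : T w y
  · rw [if_pos hT, zero_add]
    have h1 : ∀ A : Fin k → ZMod (q ^ m),
        (if syndromeDecoder T A (syndrome A (fun i => (w i : ℕ))) y = fun i => w (Fin.castAdd m i)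
          then (0 : ℝ) else 1) ≤
        ∑ w' ∈ Finset.univ.filter (fun w' => T w' y),
          if (∃ i, w' (Fin.castAdd m i) ≠ w (Fin.castAdd m i)) ∧
            syndrome A (fun i => (w' i : ℕ)) = syndrome A (fun i => (w i : ℕ)) then 1 else 0 := by
      intro A
      split_ifs with h
      · exact Finset.sum_nonneg fun _ _ => by split_ifs <;> norm_num
      · obtain ⟨w', hw', hne, hs⟩ := exists_of_syndromeDecoder_ne hT h
        refine le_trans ?_ (Finset.single_le_sum (f := fun w' =>
          if (∃ i, w' (Fin.castAdd m i) ≠ w (Fin.castAdd m i)) ∧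
            syndrome A (fun i => (w' i : ℕ)) = syndrome A (fun i => (w i : ℕ)) then (1 : ℝ) else 0)
          (fun _ _ => by split_ifs <;> norm_num) (Finset.mem_filter.mpr ⟨Finset.mem_univ w', hw'⟩))
        rw [if_pos ⟨hne, hs⟩]
    refine (Finset.sum_le_sum fun A _ => h1 A).trans ?_
    rw [Finset.sum_comm]
    have h2 : ∀ w' ∈ Finset.univ.filter (fun w' => T w' y), ∑ A : Fin k → ZMod (q ^ m),
        (if (∃ i, w' (Fin.castAdd m i) ≠ w (Fin.castAdd m i)) ∧
            syndrome A (fun i => (w' i : ℕ)) = syndrome A (fun i => (w i : ℕ)) then (1 : ℝ) else 0)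
        ≤ q * ((q : ℝ) ^ m) ^ k / (q : ℝ) ^ m := by
      intro w' _
      by_cases hne : ∃ i, w' (Fin.castAdd m i) ≠ w (Fin.castAdd m i)
      · simp only [hne, true_and]
        rw [Finset.sum_boole, le_div_iff₀ (by positivity)]
        exact_mod_cast card_filter_syndrome_eq_le w w' hne
      · simp only [hne, false_and, if_false, Finset.sum_const_zero]
        positivity
    refine (Finset.sum_le_sum h2).trans ?_
    rw [Finset.sum_const, nsmul_eq_mul]
    refine (mul_le_mul_of_nonneg_right (hL y) (by positivity)).trans (le_of_eq ?_)
    ring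
  · rw [if_neg hT]
    have : ∑ A : Fin k → ZMod (q ^ m),
      (if syndromeDecoder T A (syndrome A (fun i => (w i : ℕ))) y = fun i => w (Fin.castAdd m i)
        then (0 : ℝ) else 1) ≤ ∑ A : Fin k → ZMod (q ^ m), (1 : ℝ) :=
      Finset.sum_le_sum fun A _ => by split_ifs <;> norm_num
    refine this.trans ?_
    rw [Finset.sum_const, nsmul_eq_mul, hcard, mul_one]
    refine le_mul_of_one_le_right (by positivity) ?_
    have : 0 ≤ q * L / (q : ℝ) ^ m := by positivity
    linarith

open Classical in
/-- The decoding error probability, averaged over the linear form, the dithers and the first `k`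
symbols, in terms of the probability that the test fails for independent uniform sequences. -/
lemma sum_decodingError_le [Fintype Y] {k m : ℕ}
    (T : (Fin (k + m) → Fin (2 * q - 1)) → (Fin (k + m) → Y) → Prop) {L : ℝ}
    (hL : ∀ y, ((Finset.univ.filter fun w => T w y).card : ℝ) ≤ L)
    (p : (Fin (k + m) → ZMod q) → (Fin (k + m) → ZMod q) → (Fin (k + m) → Y) → ℝ)
    (hp : ∀ U₁ U₂ y, 0 ≤ p U₁ U₂ y) (hp1 : ∑ U₁, ∑ U₂, ∑ y, p U₁ U₂ y = 1) :
    ∑ A : Fin k → ZMod (q ^ m), ∑ d₁, ∑ u₁, ∑ d₂, ∑ u₂, ∑ y,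
      (if syndromeDecoder T A (d₁ + d₂) y = fun i => intSum (u₁ i) (u₂ i) then (0 : ℝ) else 1)
        * p (extend A d₁ u₁) (extend A d₂ u₂) y
      ≤ ((q : ℝ) ^ m) ^ k * ((∑ U₁, ∑ U₂, ∑ y,
        (if T (fun i => intSum (U₁ i) (U₂ i)) y then 0 else 1) * p U₁ U₂ y)
          + q * L / (q : ℝ) ^ m) := by
  have h1 : ∀ A : Fin k → ZMod (q ^ m), ∑ d₁, ∑ u₁, ∑ d₂, ∑ u₂, ∑ y,
      (if syndromeDecoder T A (d₁ + d₂) y = fun i => intSum (u₁ i) (u₂ i) then (0 : ℝ) else 1)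
        * p (extend A d₁ u₁) (extend A d₂ u₂) y =
      ∑ U₁, ∑ U₂, ∑ y, (if syndromeDecoder T A
          (syndrome A (fun i => ((fun i => intSum (U₁ i) (U₂ i)) i : ℕ))) y =
          fun i => (fun i => intSum (U₁ i) (U₂ i)) (Fin.castAdd m i) then (0 : ℝ) else 1)
        * p U₁ U₂ y := by
    intro A
    have h2 : ∀ d₁ u₁, ∑ d₂, ∑ u₂, ∑ y,
      (if syndromeDecoder T A (d₁ + d₂) y = fun i => intSum (u₁ i) (u₂ i) then (0 : ℝ) else 1)
        * p (extend A d₁ u₁) (extend A d₂ u₂) y = _ := fun d₁ u₁ =>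
      sum_extend A (fun u₂ d₂ U₂ => ∑ y,
        (if syndromeDecoder T A (d₁ + d₂) y = fun i => intSum (u₁ i) (u₂ i) then (0 : ℝ) else 1)
        * p (extend A d₁ u₁) U₂ y)
    simp only [h2]
    rw [sum_extend A (fun u₁ d₁ U₁ => ∑ U₂ : Fin (k + m) → ZMod q, ∑ y,
      (if syndromeDecoder T A (d₁ + syndrome A fun i => (U₂ i).val) y =
        fun i => intSum (u₁ i) (U₂ (Fin.castAdd m i)) then (0 : ℝ) else 1)
        * p U₁ U₂ y)]
    simp only [← syndrome_add]
    rfl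
  simp only [h1]
  -- The weight `p U₁ U₂ y` is now free of `A`, so `A` can be averaged first, with sequences and
  -- output fixed.
  calc _ = ∑ U₁, ∑ U₂, ∑ y, (∑ A : Fin k → ZMod (q ^ m), (if syndromeDecoder T A
          (syndrome A (fun i => ((fun i => intSum (U₁ i) (U₂ i)) i : ℕ))) y =
          fun i => (fun i => intSum (U₁ i) (U₂ i)) (Fin.castAdd m i) then (0 : ℝ) else 1))
        * p U₁ U₂ y := by
        rw [Finset.sum_comm]
        refine Finset.sum_congr rfl fun U₁ _ => ?_
        rw [Finset.sum_comm]
        refine Finset.sum_congr rfl fun U₂ _ => ?_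
        rw [Finset.sum_comm]
        refine Finset.sum_congr rfl fun y _ => ?_
        rw [Finset.sum_mul]
    _ ≤ ∑ U₁, ∑ U₂, ∑ y, (((q : ℝ) ^ m) ^ k * ((if T (fun i => intSum (U₁ i) (U₂ i)) y
          then 0 else 1) + q * L / (q : ℝ) ^ m)) * p U₁ U₂ y := by
        refine Finset.sum_le_sum fun U₁ _ => Finset.sum_le_sum fun U₂ _ =>
          Finset.sum_le_sum fun y _ => mul_le_mul_of_nonneg_right ?_ (hp _ _ _)
        exact sum_syndromeDecoder_ne_le T hL (fun i => intSum (U₁ i) (U₂ i)) y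
    _ = _ := by
        simp only [mul_assoc, add_mul, ← Finset.mul_sum, Finset.sum_add_distrib, hp1, mul_one]

end RandomCoding

/-! ### Likely sums: counting and a Chernoff bound -/

lemma sum_sum_sum_prod_eq_pow {α β γ : Type*} [Fintype α] [Fintype β] [Fintype γ] (n : ℕ)
    (g : α → β → γ → ℝ) :
    ∑ a : Fin n → α, ∑ b : Fin n → β, ∑ c : Fin n → γ, ∏ i, g (a i) (b i) (c i) =
      (∑ a, ∑ b, ∑ c, g a b c) ^ n := by
  have h1 (a : Fin n → α) (b : Fin n → β) := sum_prod_eq_prod_sum (fun i c => g (a i) (b i) c)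
  have h2 (a : Fin n → α) := sum_prod_eq_prod_sum (fun i b => ∑ c, g (a i) b c)
  have h3 := sum_prod_eq_prod_sum (fun (_ : Fin n) a => ∑ b, ∑ c, g a b c)
  simp only [h1, h2, h3, Finset.prod_const, Finset.card_univ, Fintype.card_fin]

/-- A function that equals `1` at `0` and has negative derivative there is less than `1` at some
positive point. -/
lemma exists_pos_lt_one_of_hasDerivAt {f : ℝ → ℝ} {f' : ℝ} (h : HasDerivAt f f' 0)
    (h0 : f 0 = 1) (hf' : f' < 0) : ∃ s, 0 < s ∧ f s < 1 := by
  have h1 := (hasDerivAt_iff_tendsto_slope_zero.mp h).eventually (gt_mem_nhds hf')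
  have h2 : ∀ᶠ t in 𝓝[>] (0 : ℝ), t⁻¹ • (f (0 + t) - f 0) < 0 :=
    h1.filter_mono (nhdsWithin_mono _ fun x hx => ne_of_gt hx)
  obtain ⟨t, ht, hpos⟩ := (h2.and self_mem_nhdsWithin).exists
  refine ⟨t, hpos, ?_⟩
  rw [zero_add, h0, smul_eq_mul] at ht
  have hpos' : (0 : ℝ) < t⁻¹ := inv_pos.mpr hpos
  have := neg_of_mul_neg_right ht hpos'.le
  linarith

section Typicality

variable {q : ℕ} [Fact q.Prime] {Y : Type*}

/-- The joint mass function of the integer sum and the channel output. -/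
noncomputable def sumPMF (p : ZMod q → ZMod q → Y → ℝ) (w : Fin (2 * q - 1)) (y : Y) : ℝ :=
  ∑ u₁ : ZMod q, ∑ u₂ : ZMod q, if u₁.val + u₂.val = (w : ℕ) then p u₁ u₂ y else 0

/-- The conditional mass function of the integer sum given the channel output. -/
noncomputable def condPMF (p : ZMod q → ZMod q → Y → ℝ) (w : Fin (2 * q - 1)) (y : Y) : ℝ :=
  sumPMF p w y / ∑ w', sumPMF p w' y

/-- The conditional probability of the sums given the channel outputs is at least
`2 ^ (-n τ)`. -/
def IsLikely (p : ZMod q → ZMod q → Y → ℝ) (τ : ℝ) {n : ℕ} (w : Fin n → Fin (2 * q - 1))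
    (y : Fin n → Y) : Prop :=
  1 ≤ ∏ i, (2 : ℝ) ^ τ * condPMF p (w i) (y i)

variable {p : ZMod q → ZMod q → Y → ℝ}

lemma sumPMF_nonneg (hp : ∀ u₁ u₂ y, 0 ≤ p u₁ u₂ y) (w : Fin (2 * q - 1)) (y : Y) :
    0 ≤ sumPMF p w y :=
  Finset.sum_nonneg fun _ _ => Finset.sum_nonneg fun _ _ => by
    split_ifs
    exacts [hp _ _ _, le_rfl]

lemma le_sumPMF_intSum (hp : ∀ u₁ u₂ y, 0 ≤ p u₁ u₂ y) (u₁ u₂ : ZMod q) (y : Y) :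
    p u₁ u₂ y ≤ sumPMF p (intSum u₁ u₂) y := by
  have hnn : ∀ v₁ v₂ : ZMod q,
      0 ≤ if v₁.val + v₂.val = (intSum u₁ u₂ : ℕ) then p v₁ v₂ y else 0 := fun v₁ v₂ => by
    split_ifs
    exacts [hp _ _ _, le_rfl]
  refine le_trans ?_ (Finset.single_le_sum (fun v₁ _ => Finset.sum_nonneg fun v₂ _ => hnn v₁ v₂)
    (Finset.mem_univ u₁))
  refine le_trans ?_ (Finset.single_le_sum (fun v₂ _ => hnn u₁ v₂) (Finset.mem_univ u₂))
  simp [intSum]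

lemma condPMF_nonneg (hp : ∀ u₁ u₂ y, 0 ≤ p u₁ u₂ y) (w : Fin (2 * q - 1)) (y : Y) :
    0 ≤ condPMF p w y :=
  div_nonneg (sumPMF_nonneg hp w y) (Finset.sum_nonneg fun _ _ => sumPMF_nonneg hp _ y)

lemma condPMF_intSum_pos (hp : ∀ u₁ u₂ y, 0 ≤ p u₁ u₂ y) {u₁ u₂ : ZMod q} {y : Y}
    (h : 0 < p u₁ u₂ y) : 0 < condPMF p (intSum u₁ u₂) y := by
  have h1 := h.trans_le (le_sumPMF_intSum hp u₁ u₂ y)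
  exact div_pos h1 (h1.trans_le (Finset.single_le_sum (f := fun w => sumPMF p w y)
    (fun _ _ => sumPMF_nonneg hp _ y) (Finset.mem_univ _)))

open Classical in
-- Each likely sequence has conditional probability at least `2 ^ (-nτ)`, and these probabilities
-- sum to at most one.
lemma card_filter_isLikely_le (hp : ∀ u₁ u₂ y, 0 ≤ p u₁ u₂ y) (τ : ℝ) {n : ℕ} (y : Fin n → Y) :
    ((Finset.univ.filter fun w : Fin n → Fin (2 * q - 1) => IsLikely p τ w y).card : ℝ)
      ≤ ((2 : ℝ) ^ τ) ^ n := by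
  have h0 : ∀ w : Fin n → Fin (2 * q - 1), 0 ≤ ∏ i, (2 : ℝ) ^ τ * condPMF p (w i) (y i) :=
    fun w => Finset.prod_nonneg fun i _ => mul_nonneg (by positivity) (condPMF_nonneg hp _ _)
  calc _ = ∑ w ∈ Finset.univ.filter (fun w : Fin n → Fin (2 * q - 1) => IsLikely p τ w y),
        (1 : ℝ) := by simp
    _ ≤ ∑ w ∈ Finset.univ.filter (fun w : Fin n → Fin (2 * q - 1) => IsLikely p τ w y),
        ∏ i, (2 : ℝ) ^ τ * condPMF p (w i) (y i) :=
        Finset.sum_le_sum fun w hw => (Finset.mem_filter.mp hw).2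
    _ ≤ ∑ w : Fin n → Fin (2 * q - 1), ∏ i, (2 : ℝ) ^ τ * condPMF p (w i) (y i) :=
        Finset.sum_le_sum_of_subset_of_nonneg (Finset.filter_subset _ _) fun w _ _ => h0 w
    _ = ∏ i : Fin n, ∑ w, (2 : ℝ) ^ τ * condPMF p w (y i) :=
        sum_prod_eq_prod_sum (fun i w => (2 : ℝ) ^ τ * condPMF p w (y i))
    _ ≤ ∏ _i : Fin n, (2 : ℝ) ^ τ := by
        refine Finset.prod_le_prod (fun i _ => Finset.sum_nonneg fun w _ =>
          mul_nonneg (by positivity) (condPMF_nonneg hp _ _)) fun i _ => ?_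
        rw [← Finset.mul_sum]
        refine mul_le_of_le_one_right (by positivity) ?_
        simp only [condPMF, ← Finset.sum_div]
        -- For an output of probability zero the quotient is `0 / 0 = 0`, hence an inequality rather
        -- than an equality.
        exact div_self_le_one _
    _ = _ := by simp

variable [Fintype Y]

lemma sum_sumPMF_mul (p : ZMod q → ZMod q → Y → ℝ) (f : Fin (2 * q - 1) → Y → ℝ) :
    ∑ w, ∑ y, sumPMF p w y * f w y = ∑ u₁, ∑ u₂, ∑ y, p u₁ u₂ y * f (intSum u₁ u₂) y := by
  have h1 : ∀ u₁ u₂ : ZMod q, ∀ y, ∑ w : Fin (2 * q - 1),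
      (if u₁.val + u₂.val = (w : ℕ) then p u₁ u₂ y * f w y else 0) =
        p u₁ u₂ y * f (intSum u₁ u₂) y := by
    intro u₁ u₂ y
    rw [Finset.sum_eq_single (intSum u₁ u₂)]
    · simp [intSum]
    · intro w _ hw
      rw [if_neg]
      exact fun h => hw (Fin.ext h.symm)
    · simp
  simp only [sumPMF, Finset.sum_mul, ite_mul, zero_mul, ← h1]
  calc _ = ∑ w : Fin (2 * q - 1), ∑ u₁ : ZMod q, ∑ u₂ : ZMod q, ∑ y,
        (if u₁.val + u₂.val = (w : ℕ) then p u₁ u₂ y * f w y else 0) := by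
        refine Finset.sum_congr rfl fun w _ => ?_
        rw [Finset.sum_comm]
        refine Finset.sum_congr rfl fun u₁ _ => Finset.sum_comm
    _ = _ := by
        rw [Finset.sum_comm]
        refine Finset.sum_congr rfl fun u₁ _ => ?_
        rw [Finset.sum_comm]
        refine Finset.sum_congr rfl fun u₂ _ => Finset.sum_comm

open Classical in
-- Chernoff bound: where the test fails, the product is below one and its power `-s` is at least
-- one. The resulting moment factors over the letters.
lemma sum_not_isLikely_le (hp : ∀ u₁ u₂ y, 0 ≤ p u₁ u₂ y) (τ : ℝ) {s : ℝ} (hs : 0 < s) (n : ℕ) :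
    ∑ U₁ : Fin n → ZMod q, ∑ U₂ : Fin n → ZMod q, ∑ y : Fin n → Y,
      (if IsLikely p τ (fun i => intSum (U₁ i) (U₂ i)) y then 0 else 1) *
        ∏ i, p (U₁ i) (U₂ i) (y i)
      ≤ (∑ u₁, ∑ u₂, ∑ y, p u₁ u₂ y * ((2 : ℝ) ^ τ * condPMF p (intSum u₁ u₂) y) ^ (-s)) ^ n := by
  rw [← sum_sum_sum_prod_eq_pow]
  refine Finset.sum_le_sum fun U₁ _ => Finset.sum_le_sum fun U₂ _ =>
    Finset.sum_le_sum fun y _ => ?_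
  have hb : ∀ i, 0 ≤ (2 : ℝ) ^ τ * condPMF p (intSum (U₁ i) (U₂ i)) (y i) :=
    fun i => mul_nonneg (by positivity) (condPMF_nonneg hp _ _)
  have hp0 : 0 ≤ ∏ i, p (U₁ i) (U₂ i) (y i) := Finset.prod_nonneg fun i _ => hp _ _ _
  rw [Finset.prod_mul_distrib, Real.finsetProd_rpow _ _ (fun i _ => hb i), mul_comm]
  rcases hp0.eq_or_lt with h0 | h0
  · rw [← h0]; simp
  refine mul_le_mul_of_nonneg_left ?_ hp0
  split_ifs with h
  · exact Real.rpow_nonneg (Finset.prod_nonneg fun i _ => hb i) _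
  · have hpos : 0 < ∏ i, (2 : ℝ) ^ τ * condPMF p (intSum (U₁ i) (U₂ i)) (y i) := by
      refine Finset.prod_pos fun i _ => mul_pos (by positivity) (condPMF_intSum_pos hp ?_)
      exact (hp _ _ _).lt_of_ne fun h => (Finset.prod_ne_zero_iff.mp h0.ne') i
        (Finset.mem_univ i) h.symm
    exact Real.one_le_rpow_of_pos_of_le_one_of_nonpos hpos (not_le.mp h).le (by linarith)

/-- Chain rule: both sides are the conditional entropy of the sum given the output. -/
lemma sum_mul_neg_logb_condPMF (hp : ∀ u₁ u₂ y, 0 ≤ p u₁ u₂ y) :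
    ∑ u₁, ∑ u₂, ∑ y, p u₁ u₂ y * -Real.logb 2 (condPMF p (intSum u₁ u₂) y) =
      entropy (fun wy : Fin (2 * q - 1) × Y => sumPMF p wy.1 wy.2)
        - entropy (fun y => ∑ w, sumPMF p w y) := by
  rw [← sum_sumPMF_mul p (fun w y => -Real.logb 2 (condPMF p w y))]
  have h1 : ∀ w y, sumPMF p w y * -Real.logb 2 (condPMF p w y) =
      sumPMF p w y * Real.logb 2 (∑ w', sumPMF p w' y)
        - sumPMF p w y * Real.logb 2 (sumPMF p w y) := by
    intro w y
    rcases (sumPMF_nonneg hp w y).eq_or_lt with h | h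
    · rw [← h]; simp
    · have h2 : 0 < ∑ w', sumPMF p w' y := h.trans_le (Finset.single_le_sum
        (f := fun w => sumPMF p w y) (fun _ _ => sumPMF_nonneg hp _ y) (Finset.mem_univ w))
      rw [condPMF, Real.logb_div h.ne' h2.ne']
      ring
  simp only [h1, Finset.sum_sub_distrib, entropy, Fintype.sum_prod_type]
  rw [Finset.sum_comm]
  simp only [← Finset.sum_mul]
  ring

/-- The sums and the outputs fail to be likely with exponentially small probability when `τ`
exceeds the conditional entropy. -/
lemma exists_sum_not_isLikely_base (hp : ∀ u₁ u₂ y, 0 ≤ p u₁ u₂ y)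
    (hp1 : ∑ u₁, ∑ u₂, ∑ y, p u₁ u₂ y = 1) {τ : ℝ}
    (hτ : entropy (fun wy : Fin (2 * q - 1) × Y => sumPMF p wy.1 wy.2)
        - entropy (fun y => ∑ w, sumPMF p w y) < τ) :
    ∃ s : ℝ, 0 < s ∧ ∑ u₁, ∑ u₂, ∑ y,
      p u₁ u₂ y * ((2 : ℝ) ^ τ * condPMF p (intSum u₁ u₂) y) ^ (-s) < 1 := by
  have hterm : ∀ u₁ u₂ y, HasDerivAt
      (fun s : ℝ => p u₁ u₂ y * ((2 : ℝ) ^ τ * condPMF p (intSum u₁ u₂) y) ^ (-s))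
      (Real.log 2 * (p u₁ u₂ y * -Real.logb 2 (condPMF p (intSum u₁ u₂) y) - τ * p u₁ u₂ y))
      0 := by
    intro u₁ u₂ y
    -- Triples of weight zero are separated since the base of the power may vanish there, while the
    -- weighted term is constantly zero.
    rcases (hp u₁ u₂ y).eq_or_lt with h | h
    · rw [← h]
      simpa using hasDerivAt_const (0 : ℝ) (0 : ℝ)
    · have hc := condPMF_intSum_pos hp h
      have hb : 0 < (2 : ℝ) ^ τ * condPMF p (intSum u₁ u₂) y := mul_pos (by positivity) hc
      have hd := ((hasDerivAt_neg (0 : ℝ)).const_rpow hb).const_mul (p u₁ u₂ y)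
      refine hd.congr_deriv ?_
      rw [Real.log_mul (by positivity) hc.ne', Real.log_rpow (by norm_num), neg_zero,
        Real.rpow_zero, Real.logb]
      have : Real.log 2 ≠ 0 := (Real.log_pos (by norm_num)).ne'
      field_simp
      ring
  have hd := HasDerivAt.fun_sum (u := Finset.univ) fun u₁ _ =>
    HasDerivAt.fun_sum (u := Finset.univ) fun u₂ _ =>
      HasDerivAt.fun_sum (u := Finset.univ) fun y _ => hterm u₁ u₂ y
  refine exists_pos_lt_one_of_hasDerivAt hd (by simpa using hp1) ?_
  simp only [← Finset.mul_sum, Finset.sum_sub_distrib, hp1, sum_mul_neg_logb_condPMF hp]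
  exact mul_neg_of_pos_of_neg (Real.log_pos (by norm_num)) (by linarith)

end Typicality

/-! ### Derandomisation, random letterwise maps and the resulting codes -/

lemma exists_le_of_weighted_sum_le {ι : Type*} [Fintype ι] {w F : ι → ℝ} {B : ℝ}
    (hw : ∀ i, 0 ≤ w i) (hpos : 0 < ∑ i, w i) (h : ∑ i, w i * F i ≤ (∑ i, w i) * B) :
    ∃ i, F i ≤ B := by
  by_contra! hlt
  obtain ⟨i, -, hi⟩ := Finset.exists_lt_of_sum_lt (s := Finset.univ) (f := fun _ : ι => (0 : ℝ))
    (g := w) (by simpa using hpos)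
  refine absurd h (not_le.mpr ?_)
  rw [Finset.sum_mul]
  exact Finset.sum_lt_sum (fun j _ => mul_le_mul_of_nonneg_left (hlt j).le (hw j))
    ⟨i, Finset.mem_univ i, mul_lt_mul_of_pos_left (hlt i) hi⟩

/-- Drawing all values of a map independently, the value at a given point has the prescribed
distribution. -/
lemma sum_prod_mul_apply {κ X : Type*} [Fintype κ] [DecidableEq κ] [Fintype X] {v : κ → X → ℝ}
    (hv : ∀ u, ∑ x, v u x = 1) (u₀ : κ) (F : X → ℝ) :
    ∑ g : κ → X, (∏ u, v u (g u)) * F (g u₀) = ∑ x, v u₀ x * F x := by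
  have h1 : ∀ g : κ → X, (∏ u, v u (g u)) * F (g u₀) =
      ∏ u, v u (g u) * (if u = u₀ then F (g u) else 1) := by
    intro g
    rw [Finset.prod_mul_distrib, Finset.prod_ite_eq' Finset.univ u₀ (fun u => F (g u)),
      if_pos (Finset.mem_univ _)]
  simp only [h1]
  rw [sum_prod_eq_prod_sum (fun u x => v u x * if u = u₀ then F x else 1),
    Finset.prod_eq_single u₀ (fun u _ hu => by simp [hu, hv u]) (by simp)]
  simp

lemma sum_toReal_pmf {X : Type*} [Fintype X] (p : PMF X) : ∑ x, (p x).toReal = 1 := by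
  rw [← ENNReal.toReal_sum fun x _ => p.apply_ne_top x,
    (tsum_fintype _).symm.trans p.tsum_coe, ENNReal.toReal_one]

section Code

variable {q : ℕ} [Fact q.Prime] {X₁ X₂ Y : Type*}

section Strategy

variable [Fintype X₁] [Fintype X₂] (V₁ : ZMod q → PMF X₁) (V₂ : ZMod q → PMF X₂)
  (P : X₁ → X₂ → PMF Y)

/-- The probability of a pair of maps `ZMod q → X_j` whose values are drawn independently
from `V_j`. -/
noncomputable def strategyWeight (g : (ZMod q → X₁) × (ZMod q → X₂)) : ℝ :=
  (∏ u, (V₁ u (g.1 u)).toReal) * ∏ u, (V₂ u (g.2 u)).toReal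

omit [Fintype X₁] [Fintype X₂] in
lemma strategyWeight_nonneg (g : (ZMod q → X₁) × (ZMod q → X₂)) : 0 ≤ strategyWeight V₁ V₂ g :=
  mul_nonneg (Finset.prod_nonneg fun _ _ => ENNReal.toReal_nonneg)
    (Finset.prod_nonneg fun _ _ => ENNReal.toReal_nonneg)

lemma sum_strategyWeight : ∑ g, strategyWeight V₁ V₂ g = 1 := by
  have h1 := sum_prod_eq_prod_sum (fun u x => (V₁ u x).toReal)
  have h2 := sum_prod_eq_prod_sum (fun u x => (V₂ u x).toReal)
  simp only [sum_toReal_pmf, Finset.prod_const_one] at h1 h2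
  simp only [strategyWeight, Fintype.sum_prod_type, ← Finset.mul_sum, h1, h2, mul_one]

/-- The channel sees each map at one point only, where its value has law `V_j`; the factor `q ^ 2`
cancels the uniform weights in `PUUY`. -/
lemma sum_strategyWeight_mul (u₁ u₂ : ZMod q) (y : Y) :
    ∑ g, strategyWeight V₁ V₂ g * (P (g.1 u₁) (g.2 u₂) y).toReal =
      (q : ℝ) ^ 2 * PUUY q V₁ V₂ P u₁ u₂ y := by
  have hq : (q : ℝ) ≠ 0 := by exact_mod_cast (Fact.out : q.Prime).ne_zero
  have h2 : ∀ x₁, ∑ g : ZMod q → X₂, (∏ u, (V₂ u (g u)).toReal) * (P x₁ (g u₂) y).toReal =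
      ∑ x₂, (V₂ u₂ x₂).toReal * (P x₁ x₂ y).toReal := fun x₁ =>
    sum_prod_mul_apply (fun u => sum_toReal_pmf (V₂ u)) u₂ fun x₂ => (P x₁ x₂ y).toReal
  have h1 := sum_prod_mul_apply (fun u => sum_toReal_pmf (V₁ u)) u₁ fun x₁ =>
    ∑ x₂, (V₂ u₂ x₂).toReal * (P x₁ x₂ y).toReal
  simp only [strategyWeight, Fintype.sum_prod_type, mul_assoc, ← Finset.mul_sum, h2, h1, PUUY, PU]
  simp only [Finset.mul_sum]
  refine Finset.sum_congr rfl fun x₁ _ => Finset.sum_congr rfl fun x₂ _ => ?_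
  field_simp

omit [Fact q.Prime] in
lemma PUUY_nonneg (u₁ u₂ : ZMod q) (y : Y) : 0 ≤ PUUY q V₁ V₂ P u₁ u₂ y :=
  Finset.sum_nonneg fun _ _ => Finset.sum_nonneg fun _ _ => by unfold PU; positivity

omit [Fact q.Prime] in
lemma sum_PUUY_output [Fintype Y] (u₁ u₂ : ZMod q) :
    ∑ y, PUUY q V₁ V₂ P u₁ u₂ y = PU q u₁ * PU q u₂ := by
  simp only [PUUY]
  rw [Finset.sum_comm]
  have h : ∀ x₁ : X₁, ∑ y, ∑ x₂, PU q u₁ * PU q u₂ * (V₁ u₁ x₁).toReal * (V₂ u₂ x₂).toReal *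
      (P x₁ x₂ y).toReal = PU q u₁ * PU q u₂ * (V₁ u₁ x₁).toReal := by
    intro x₁
    rw [Finset.sum_comm]
    simp only [← Finset.mul_sum, sum_toReal_pmf, mul_one]
  simp only [h, ← Finset.mul_sum, sum_toReal_pmf, mul_one]

lemma sum_PUUY [Fintype Y] : ∑ u₁, ∑ u₂, ∑ y, PUUY q V₁ V₂ P u₁ u₂ y = 1 := by
  have hq : (q : ℝ) ≠ 0 := by exact_mod_cast (Fact.out : q.Prime).ne_zero
  simp [sum_PUUY_output, PU, ZMod.card, hq]

lemma sum_prod_strategyWeight_mul {n : ℕ} (c₁ c₂ : Fin n → ZMod q) (y : Fin n → Y) :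
    ∑ f : Fin n → (ZMod q → X₁) × (ZMod q → X₂), (∏ i, strategyWeight V₁ V₂ (f i)) *
      ∏ i, (P ((f i).1 (c₁ i)) ((f i).2 (c₂ i)) (y i)).toReal =
      ((q : ℝ) ^ 2) ^ n * ∏ i, PUUY q V₁ V₂ P (c₁ i) (c₂ i) (y i) := by
  simp only [← Finset.prod_mul_distrib]
  rw [sum_prod_eq_prod_sum (fun i (g : (ZMod q → X₁) × (ZMod q → X₂)) =>
    strategyWeight V₁ V₂ g * (P (g.1 (c₁ i)) (g.2 (c₂ i)) (y i)).toReal)]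
  simp only [sum_strategyWeight_mul, Finset.prod_mul_distrib, Finset.prod_const, Finset.card_univ,
    Fintype.card_fin]

end Strategy

variable {M N : Type*}

lemma append_add_injective {k : ℕ} (m : ℕ) {ι : M → Fin k → ZMod q} (h : Function.Injective ι)
    (e : Fin k → ZMod q) :
    Function.Injective fun a => (Fin.append (ι a + e) 0 : Fin (k + m) → ZMod q) := by
  intro a a' haa
  refine h (add_right_cancel (b := e) (funext fun i => ?_))
  simpa only [Fin.append_left] using congrFun haa (Fin.castAdd m i)

/-- The computation code whose codewords are dithered and padded with zeros; the channel inputs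
are letterwise images of the first `k` symbols extended by the digits of a dithered linear hash. -/
noncomputable def hashCode {k m : ℕ} {ι₁ : M → Fin k → ZMod q} {ι₂ : N → Fin k → ZMod q}
    (h₁ : Function.Injective ι₁) (h₂ : Function.Injective ι₂)
    (T : (Fin (k + m) → Fin (2 * q - 1)) → (Fin (k + m) → Y) → Prop)
    (A : Fin k → ZMod (q ^ m)) (d₁ d₂ : ZMod (q ^ m)) (e₁ e₂ : Fin k → ZMod q)
    (f : Fin (k + m) → (ZMod q → X₁) × (ZMod q → X₂)) :
    ComputationCode q X₁ X₂ Y M N (k + m) where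
  t a := Fin.append (ι₁ a + e₁) 0
  v b := Fin.append (ι₂ b + e₂) 0
  t_injective := append_add_injective m h₁ e₁
  v_injective := append_add_injective m h₂ e₂
  enc₁ c i := (f i).1 (extend A d₁ (fun j => c (Fin.castAdd m j)) i)
  enc₂ c i := (f i).2 (extend A d₂ (fun j => c (Fin.castAdd m j)) i)
  dec y := Fin.append (syndromeDecoder T A (d₁ + d₂) y) fun _ => intSum 0 0

-- The last `m` symbols of both codewords are zero and are always decoded correctly, so only the
-- syndrome decoder can err.
open Classical in
lemma hashCode_condError [Fintype Y] {k m : ℕ} {ι₁ : M → Fin k → ZMod q}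
    {ι₂ : N → Fin k → ZMod q} (h₁ : Function.Injective ι₁) (h₂ : Function.Injective ι₂)
    (T : (Fin (k + m) → Fin (2 * q - 1)) → (Fin (k + m) → Y) → Prop)
    (A : Fin k → ZMod (q ^ m)) (d₁ d₂ : ZMod (q ^ m)) (e₁ e₂ : Fin k → ZMod q)
    (f : Fin (k + m) → (ZMod q → X₁) × (ZMod q → X₂)) (P : X₁ → X₂ → PMF Y) (a : M) (b : N) :
    (hashCode h₁ h₂ T A d₁ d₂ e₁ e₂ f).condError P a b =
      ∑ y, (if syndromeDecoder T A (d₁ + d₂) y =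
          fun i => intSum ((ι₁ a + e₁) i) ((ι₂ b + e₂) i) then 0 else 1) *
        ∏ i, (P ((f i).1 (extend A d₁ (ι₁ a + e₁) i)) ((f i).2 (extend A d₂ (ι₂ b + e₂) i))
          (y i)).toReal := by
  refine Finset.sum_congr rfl fun y _ => ?_
  have hiff : (∀ i, ((hashCode h₁ h₂ T A d₁ d₂ e₁ e₂ f).dec y i : ℕ) =
      ((hashCode h₁ h₂ T A d₁ d₂ e₁ e₂ f).t a i).val +
        ((hashCode h₁ h₂ T A d₁ d₂ e₁ e₂ f).v b i).val) ↔
      syndromeDecoder T A (d₁ + d₂) y = fun i => intSum ((ι₁ a + e₁) i) ((ι₂ b + e₂) i) := by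
    constructor
    · intro h
      funext i
      have := h (Fin.castAdd m i)
      simp only [hashCode, Fin.append_left] at this
      exact Fin.ext this
    · intro h i
      refine Fin.addCases (fun i => ?_) (fun i => ?_) i
      · simp only [hashCode, Fin.append_left, h]
        rfl
      · simp [hashCode, intSum]
  by_cases h : syndromeDecoder T A (d₁ + d₂) y =
      fun i => intSum ((ι₁ a + e₁) i) ((ι₂ b + e₂) i)
  · rw [if_pos (hiff.mpr h), if_pos h, zero_mul]
  · rw [if_neg (mt hiff.mp h), if_neg h, one_mul]
    simp only [hashCode, Fin.append_left]

/-- Random coding over hash, syndromes, dithers and letterwise maps: the bound holds for the mean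
error of each message pair, hence for the mean of the average error, hence for some choice. -/
theorem exists_hashCode_avgError_le [Fintype X₁] [Fintype X₂] [Fintype Y] [Fintype M] [Fintype N]
    [Nonempty M] [Nonempty N] {k m : ℕ} {ι₁ : M → Fin k → ZMod q} {ι₂ : N → Fin k → ZMod q}
    (h₁ : Function.Injective ι₁) (h₂ : Function.Injective ι₂) (P : X₁ → X₂ → PMF Y)
    (V₁ : ZMod q → PMF X₁) (V₂ : ZMod q → PMF X₂) (τ : ℝ) {s : ℝ} (hs : 0 < s) :
    ∃ T A d₁ d₂ e₁ e₂ f,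
      (hashCode (m := m) h₁ h₂ T A d₁ d₂ e₁ e₂ f : ComputationCode q X₁ X₂ Y M N _).avgError P ≤
        (∑ u₁, ∑ u₂, ∑ y, PUUY q V₁ V₂ P u₁ u₂ y *
          ((2 : ℝ) ^ τ * condPMF (PUUY q V₁ V₂ P) (intSum u₁ u₂) y) ^ (-s)) ^ (k + m)
        + q * ((2 : ℝ) ^ τ) ^ (k + m) / (q : ℝ) ^ m := by
  classical
  set p := PUUY q V₁ V₂ P with hpdef
  have hp : ∀ u₁ u₂ y, 0 ≤ p u₁ u₂ y := PUUY_nonneg V₁ V₂ P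
  have hp1 : ∑ u₁, ∑ u₂, ∑ y, p u₁ u₂ y = 1 := sum_PUUY V₁ V₂ P
  have hq : (0 : ℝ) < q := by exact_mod_cast (Fact.out : q.Prime).pos
  set T := fun (w : Fin (k + m) → Fin (2 * q - 1)) (y : Fin (k + m) → Y) => IsLikely p τ w y
  set B := (∑ u₁, ∑ u₂, ∑ y, p u₁ u₂ y *
    ((2 : ℝ) ^ τ * condPMF p (intSum u₁ u₂) y) ^ (-s)) ^ (k + m)
      + q * ((2 : ℝ) ^ τ) ^ (k + m) / (q : ℝ) ^ m with hB
  set Ω := fun f : Fin (k + m) → (ZMod q → X₁) × (ZMod q → X₂) =>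
    ∏ i, strategyWeight V₁ V₂ (f i) with hΩ
  have hΩ0 : ∀ f, 0 ≤ Ω f := fun f => Finset.prod_nonneg fun i _ => strategyWeight_nonneg _ _ _
  have hΩ1 : ∑ f, Ω f = 1 := by
    rw [hΩ, sum_prod_eq_prod_sum (fun _ g => strategyWeight V₁ V₂ g)]
    simp [sum_strategyWeight]
  refine ⟨T, ?_⟩
  set code := fun A d₁ e₁ d₂ e₂ f =>
    (hashCode h₁ h₂ T A d₁ d₂ e₁ e₂ f : ComputationCode q X₁ X₂ Y M N _) with hcode
  have hmain : ∀ a b, ∑ A, ∑ d₁, ∑ e₁, ∑ d₂, ∑ e₂, ∑ f,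
      Ω f * (code A d₁ e₁ d₂ e₂ f).condError P a b ≤
        ((q : ℝ) ^ 2) ^ (k + m) * (((q : ℝ) ^ m) ^ k * B) := by
    intro a b
    have hf : ∀ A d₁ e₁ d₂ e₂, ∑ f, Ω f * (code A d₁ e₁ d₂ e₂ f).condError P a b =
        ((q : ℝ) ^ 2) ^ (k + m) * ∑ y, (if syndromeDecoder T A (d₁ + d₂) y =
          fun i => intSum ((ι₁ a + e₁) i) ((ι₂ b + e₂) i) then 0 else 1) *
          ∏ i, p (extend A d₁ (ι₁ a + e₁) i) (extend A d₂ (ι₂ b + e₂) i) (y i) := by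
      intro A d₁ e₁ d₂ e₂
      simp only [hcode, hashCode_condError, Finset.mul_sum]
      rw [Finset.sum_comm]
      refine Finset.sum_congr rfl fun y _ => ?_
      rw [mul_left_comm, ← sum_prod_strategyWeight_mul V₁ V₂ P, Finset.mul_sum]
      refine Finset.sum_congr rfl fun f _ => ?_
      ring
    -- Translation by the message permutes the dithers, so the mean error is the same for all
    -- message pairs.
    have he₂ : ∀ A d₁ u₁ d₂, ∑ e₂, ∑ y, (if syndromeDecoder T A (d₁ + d₂) y =
          fun i => intSum (u₁ i) ((ι₂ b + e₂) i) then (0 : ℝ) else 1) *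
          ∏ i, p (extend A d₁ u₁ i) (extend A d₂ (ι₂ b + e₂) i) (y i) =
        ∑ u₂, ∑ y, (if syndromeDecoder T A (d₁ + d₂) y =
          fun i => intSum (u₁ i) (u₂ i) then (0 : ℝ) else 1) *
          ∏ i, p (extend A d₁ u₁ i) (extend A d₂ u₂ i) (y i) := fun A d₁ u₁ d₂ =>
      Equiv.sum_comp (Equiv.addLeft (ι₂ b)) fun u₂ => ∑ y, (if syndromeDecoder T A (d₁ + d₂) y =
          fun i => intSum (u₁ i) (u₂ i) then (0 : ℝ) else 1) *
          ∏ i, p (extend A d₁ u₁ i) (extend A d₂ u₂ i) (y i)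
    have he₁ : ∀ A d₁, ∑ e₁, ∑ d₂, ∑ u₂, ∑ y, (if syndromeDecoder T A (d₁ + d₂) y =
          fun i => intSum ((ι₁ a + e₁) i) (u₂ i) then (0 : ℝ) else 1) *
          ∏ i, p (extend A d₁ (ι₁ a + e₁) i) (extend A d₂ u₂ i) (y i) =
        ∑ u₁, ∑ d₂, ∑ u₂, ∑ y, (if syndromeDecoder T A (d₁ + d₂) y =
          fun i => intSum (u₁ i) (u₂ i) then (0 : ℝ) else 1) *
          ∏ i, p (extend A d₁ u₁ i) (extend A d₂ u₂ i) (y i) := fun A d₁ =>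
      Equiv.sum_comp (Equiv.addLeft (ι₁ a)) fun u₁ => ∑ d₂, ∑ u₂, ∑ y,
          (if syndromeDecoder T A (d₁ + d₂) y =
          fun i => intSum (u₁ i) (u₂ i) then (0 : ℝ) else 1) *
          ∏ i, p (extend A d₁ u₁ i) (extend A d₂ u₂ i) (y i)
    simp only [hf, ← Finset.mul_sum, he₂, he₁]
    refine mul_le_mul_of_nonneg_left ?_ (by positivity)
    refine (sum_decodingError_le T (card_filter_isLikely_le hp τ)
      (fun U₁ U₂ y => ∏ i, p (U₁ i) (U₂ i) (y i))
      (fun _ _ _ => Finset.prod_nonneg fun _ _ => hp _ _ _)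
      (by rw [sum_sum_sum_prod_eq_pow, hp1, one_pow])).trans ?_
    refine mul_le_mul_of_nonneg_left ?_ (by positivity)
    exact add_le_add_left (sum_not_isLikely_le hp τ hs (k + m)) _
  have hW : ∑ ψ : (Fin k → ZMod (q ^ m)) × ZMod (q ^ m) × (Fin k → ZMod q) × ZMod (q ^ m) ×
      (Fin k → ZMod q) × (Fin (k + m) → (ZMod q → X₁) × (ZMod q → X₂)), Ω ψ.2.2.2.2.2 =
      ((q : ℝ) ^ 2) ^ (k + m) * ((q : ℝ) ^ m) ^ k := by
    simp only [Fintype.sum_prod_type, hΩ1]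
    simp [ZMod.card]
    ring
  have hmn : (Fintype.card M : ℝ) ≠ 0 ∧ (Fintype.card N : ℝ) ≠ 0 :=
    ⟨by exact_mod_cast Fintype.card_ne_zero, by exact_mod_cast Fintype.card_ne_zero⟩
  obtain ⟨⟨A, d₁, e₁, d₂, e₂, f⟩, h⟩ := exists_le_of_weighted_sum_le
    (w := fun ψ : (Fin k → ZMod (q ^ m)) × ZMod (q ^ m) × (Fin k → ZMod q) × ZMod (q ^ m) ×
      (Fin k → ZMod q) × (Fin (k + m) → (ZMod q → X₁) × (ZMod q → X₂)) => Ω ψ.2.2.2.2.2)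
    (F := fun ψ => (code ψ.1 ψ.2.1 ψ.2.2.1 ψ.2.2.2.1 ψ.2.2.2.2.1 ψ.2.2.2.2.2).avgError P)
    (B := B) (fun ψ => hΩ0 _) (by rw [hW]; positivity) (by
      rw [hW]
      simp only [ComputationCode.avgError, Finset.mul_sum]
      rw [Finset.sum_comm]
      have hab : ∀ a : M, ∀ b : N, ∑ ψ : (Fin k → ZMod (q ^ m)) × ZMod (q ^ m) ×
          (Fin k → ZMod q) × ZMod (q ^ m) × (Fin k → ZMod q) ×
          (Fin (k + m) → (ZMod q → X₁) × (ZMod q → X₂)), Ω ψ.2.2.2.2.2 *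
          (1 / (Fintype.card M : ℝ) * (1 / (Fintype.card N : ℝ)) *
          (code ψ.1 ψ.2.1 ψ.2.2.1 ψ.2.2.2.1 ψ.2.2.2.2.1 ψ.2.2.2.2.2).condError P a b) ≤
          1 / (Fintype.card M : ℝ) * (1 / (Fintype.card N : ℝ)) *
          (((q : ℝ) ^ 2) ^ (k + m) * (((q : ℝ) ^ m) ^ k * B)) := by
        intro a b
        simp only [mul_left_comm (Ω _), ← Finset.mul_sum]
        refine mul_le_mul_of_nonneg_left ?_ (by positivity)
        simp only [Fintype.sum_prod_type]
        exact hmain a b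
      refine (Finset.sum_le_sum fun a _ => ?_).trans (le_of_eq ?_) (b := ∑ _a : M, ∑ _b : N,
        1 / (Fintype.card M : ℝ) * (1 / (Fintype.card N : ℝ)) *
          (((q : ℝ) ^ 2) ^ (k + m) * (((q : ℝ) ^ m) ^ k * B)))
      · rw [Finset.sum_comm]
        exact Finset.sum_le_sum fun b _ => hab a b
      · simp only [Finset.sum_const, Finset.card_univ, nsmul_eq_mul]
        field_simp [hmn.1, hmn.2])
  exact ⟨A, d₁, d₂, e₁, e₂, f, h⟩

end Code

/-! ### Padding as a linear code, and the one-message code -/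

lemma zeroPad_injective {q k l : ℕ} (h : k ≤ l) :
    Function.Injective (zeroPad l : (Fin k → ZMod q) → Fin l → ZMod q) := by
  intro m m' hm
  funext i
  simpa [zeroPad] using congrFun hm (Fin.castLE h i)

lemma append_add_zero_eq {q k m : ℕ} (u e : Fin k → ZMod q) :
    Fin.append (u + e) (0 : Fin m → ZMod q) = zeroPad (k + m) u + Fin.append e 0 := by
  funext i
  refine Fin.addCases (fun i => ?_) (fun i => ?_) i <;> simp [zeroPad]

/-- The matrix that appends zeros to a vector. -/
def padMatrix (q n l : ℕ) : Matrix (Fin n) (Fin l) (ZMod q) :=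
  Matrix.of fun i j => if (i : ℕ) = j then 1 else 0

lemma padMatrix_mulVec {q n l : ℕ} (x : Fin l → ZMod q) :
    (padMatrix q n l).mulVec x = zeroPad n x := by
  funext i
  simp only [padMatrix, Matrix.mulVec, dotProduct, Matrix.of_apply, ite_mul, one_mul, zero_mul,
    zeroPad]
  split_ifs with h
  · rw [Finset.sum_eq_single ⟨i, h⟩ (fun j _ hj => if_neg fun hij => hj (Fin.ext hij.symm))
      (by simp)]
    simp
  · exact Finset.sum_eq_zero fun j _ => if_neg fun hij : (i : ℕ) = j => h (hij ▸ j.is_lt)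

lemma ComputationCode.avgError_nonneg {q n : ℕ} {X₁ X₂ Y M N : Type*} [Fintype Y] [Fintype M]
    [Fintype N] (c : ComputationCode q X₁ X₂ Y M N n) (P : X₁ → X₂ → PMF Y) :
    0 ≤ c.avgError P := by
  refine Finset.sum_nonneg fun a _ => Finset.sum_nonneg fun b _ => mul_nonneg (by positivity)
    (Finset.sum_nonneg fun y _ => ?_)
  split_ifs
  exacts [le_rfl, Finset.prod_nonneg fun _ _ => ENNReal.toReal_nonneg]

section Single

variable {q : ℕ} [Fact q.Prime] {X₁ X₂ Y M N : Type*}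

/-- The code in which both users use the zero codeword for their only message. -/
def zeroCode [Subsingleton M] [Subsingleton N] (x₁ : X₁) (x₂ : X₂) (n : ℕ) :
    ComputationCode q X₁ X₂ Y M N n where
  t _ := 0
  v _ := 0
  t_injective := Function.injective_of_subsingleton _
  v_injective := Function.injective_of_subsingleton _
  enc₁ _ _ := x₁
  enc₂ _ _ := x₂
  dec _ _ := intSum 0 0

lemma zeroCode_avgError [Fintype Y] [Fintype M] [Fintype N] [Subsingleton M] [Subsingleton N]
    (x₁ : X₁) (x₂ : X₂) (n : ℕ) (P : X₁ → X₂ → PMF Y) :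
    (zeroCode x₁ x₂ n : ComputationCode q X₁ X₂ Y M N n).avgError P = 0 := by
  simp [ComputationCode.avgError, ComputationCode.condError, zeroCode, intSum]

lemma zeroCode_isNestedLinear {k₁ k₂ n : ℕ} [Subsingleton (Fin k₁ → ZMod q)]
    [Subsingleton (Fin k₂ → ZMod q)] (h₁ : k₁ = 0) (h₂ : k₂ = 0) (x₁ : X₁) (x₂ : X₂) :
    (zeroCode x₁ x₂ n : ComputationCode q X₁ X₂ Y (Fin k₁ → ZMod q)
      (Fin k₂ → ZMod q) n).IsNestedLinear := by
  subst h₁ h₂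
  have : IsEmpty (Fin (max 0 0)) := by rw [max_self]; infer_instance
  refine ⟨0, 0, 0, Function.injective_of_subsingleton _, fun m => ?_, fun m => ?_⟩ <;>
    simp [zeroCode]

end Single

/-! ### From error bounds to achievable rates -/

section Achievability

variable {q : ℕ} [Fact q.Prime] {X₁ X₂ Y : Type*} [Fintype X₁] [Fintype X₂] [Fintype Y]

lemma mutualInfo_sub_D (P : X₁ → X₂ → PMF Y) (V₁ : ZMod q → PMF X₁) (V₂ : ZMod q → PMF X₂) :
    mutualInfo (PWY q V₁ V₂ P) - D q = Real.logb 2 q -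
      (entropy (fun wy : Fin (2 * q - 1) × Y => sumPMF (PUUY q V₁ V₂ P) wy.1 wy.2)
        - entropy (fun y => ∑ w, sumPMF (PUUY q V₁ V₂ P) w y)) := by
  have h : (fun w => ∑ y, PWY q V₁ V₂ P w y) = PW q := by
    funext w
    simp only [PWY, PW]
    rw [Finset.sum_comm]
    refine Finset.sum_congr rfl fun u₁ _ => ?_
    rw [Finset.sum_comm]
    refine Finset.sum_congr rfl fun u₂ _ => ?_
    split_ifs
    · exact sum_PUUY_output V₁ V₂ P u₁ u₂
    · simp
  rw [mutualInfo, D, h]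
  simp only [PWY, sumPMF]
  ring

lemma exists_code_avgError_le {M N : Type*} [Fintype M] [Fintype N] [Nonempty M] [Nonempty N]
    {n k : ℕ} (hk : k ≤ n) {ι₁ : M → Fin k → ZMod q} {ι₂ : N → Fin k → ZMod q}
    (h₁ : Function.Injective ι₁) (h₂ : Function.Injective ι₂) (P : X₁ → X₂ → PMF Y)
    (V₁ : ZMod q → PMF X₁) (V₂ : ZMod q → PMF X₂) (τ : ℝ) {s : ℝ} (hs : 0 < s) {R : ℝ}
    (hR : (q : ℝ) ^ k ≤ q * ((2 : ℝ) ^ R) ^ n) :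
    ∃ c : ComputationCode q X₁ X₂ Y M N n,
      (∃ d₁ d₂, (∀ a, c.t a = zeroPad n (ι₁ a) + d₁) ∧ ∀ b, c.v b = zeroPad n (ι₂ b) + d₂) ∧
      c.avgError P ≤ (∑ u₁, ∑ u₂, ∑ y, PUUY q V₁ V₂ P u₁ u₂ y *
          ((2 : ℝ) ^ τ * condPMF (PUUY q V₁ V₂ P) (intSum u₁ u₂) y) ^ (-s)) ^ n
        + (q : ℝ) ^ 2 * ((2 : ℝ) ^ (τ + R) / q) ^ n := by
  have hq : (0 : ℝ) < q := by exact_mod_cast (Fact.out : q.Prime).pos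
  obtain ⟨m, rfl⟩ := Nat.exists_eq_add_of_le hk
  obtain ⟨T, A, d₁, d₂, e₁, e₂, f, h⟩ :=
    exists_hashCode_avgError_le (m := m) h₁ h₂ P V₁ V₂ τ hs
  refine ⟨_, ⟨Fin.append e₁ 0, Fin.append e₂ 0, fun a => append_add_zero_eq _ _,
    fun b => append_add_zero_eq _ _⟩, h.trans ?_⟩
  -- Here `q ^ m = q ^ n / q ^ k`. One factor `q` comes from hash collisions, the other from
  -- rounding `k` up in `hR`.
  refine add_le_add_right ?_ _
  calc q * ((2 : ℝ) ^ τ) ^ (k + m) / (q : ℝ) ^ m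
      = q * ((2 : ℝ) ^ τ) ^ (k + m) * (q : ℝ) ^ k / (q : ℝ) ^ (k + m) := by
        rw [pow_add (q : ℝ)]
        field_simp
    _ ≤ q * ((2 : ℝ) ^ τ) ^ (k + m) * (q * ((2 : ℝ) ^ R) ^ (k + m)) / (q : ℝ) ^ (k + m) := by
        gcongr
    _ = _ := by
        rw [Real.rpow_add (by norm_num), div_pow, mul_pow]
        ring

lemma exists_codes_tendsto {M N : ℕ → Type*} [∀ n, Fintype (M n)] [∀ n, Fintype (N n)]
    [∀ n, Nonempty (M n)] [∀ n, Nonempty (N n)] (P : X₁ → X₂ → PMF Y)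
    (V₁ : ZMod q → PMF X₁) (V₂ : ZMod q → PMF X₂) {R : ℝ}
    (hR : R < mutualInfo (PWY q V₁ V₂ P) - D q) {k : ℕ → ℕ} (hk : ∀ n, k n ≤ n)
    (hkR : ∀ n, (k n : ℝ) ≤ n * R / Real.logb 2 q + 1)
    {ι₁ : ∀ n, M n → Fin (k n) → ZMod q} {ι₂ : ∀ n, N n → Fin (k n) → ZMod q}
    (h₁ : ∀ n, Function.Injective (ι₁ n)) (h₂ : ∀ n, Function.Injective (ι₂ n)) :
    ∃ c : ∀ n, ComputationCode q X₁ X₂ Y (M n) (N n) n,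
      (∀ n, ∃ d₁ d₂, (∀ a, (c n).t a = zeroPad n (ι₁ n a) + d₁) ∧
        ∀ b, (c n).v b = zeroPad n (ι₂ n b) + d₂) ∧
      Tendsto (fun n => (c n).avgError P) atTop (𝓝 0) := by
  have hq1 : (1 : ℝ) < q := by exact_mod_cast (Fact.out : q.Prime).one_lt
  have hq : (0 : ℝ) < q := zero_lt_one.trans hq1
  have hlog : 0 < Real.logb 2 q := Real.logb_pos (by norm_num) hq1
  have h2log : (2 : ℝ) ^ Real.logb 2 q = q := Real.rpow_logb (by norm_num) (by norm_num) hq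
  rw [mutualInfo_sub_D, lt_sub_comm] at hR
  -- `τ` lies strictly between `H(W|Y)` and `log q - R`: the lower bound makes the true sum likely,
  -- the upper one makes collisions rare.
  obtain ⟨τ, hτ, hτR⟩ := exists_between hR
  have hp := PUUY_nonneg (q := q) V₁ V₂ P
  obtain ⟨s, hs, hlt⟩ := exists_sum_not_isLikely_base hp (sum_PUUY V₁ V₂ P) hτ
  have hpow : ∀ n, (q : ℝ) ^ k n ≤ q * ((2 : ℝ) ^ R) ^ n := by
    intro n
    calc (q : ℝ) ^ k n = (q : ℝ) ^ (k n : ℝ) := (Real.rpow_natCast _ _).symm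
      _ ≤ (q : ℝ) ^ (n * R / Real.logb 2 q + 1) := Real.rpow_le_rpow_of_exponent_le hq1.le (hkR n)
      _ = _ := by
        rw [Real.rpow_add hq, Real.rpow_one, mul_comm]
        congr 1
        nth_rewrite 1 [← h2log]
        rw [← Real.rpow_mul (by norm_num), ← Real.rpow_natCast, ← Real.rpow_mul (by norm_num),
          mul_div_cancel₀ _ hlog.ne', mul_comm]
  choose c hc hle using fun n => exists_code_avgError_le (hk n) (h₁ n) (h₂ n) P V₁ V₂ τ hs (hpow n)
  refine ⟨c, hc, squeeze_zero (fun n => (c n).avgError_nonneg P) hle ?_⟩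
  have t1 := tendsto_pow_atTop_nhds_zero_of_lt_one (Finset.sum_nonneg fun u₁ _ =>
    Finset.sum_nonneg fun u₂ _ => Finset.sum_nonneg fun y _ => mul_nonneg (hp u₁ u₂ y)
      (Real.rpow_nonneg (mul_nonneg (by positivity) (condPMF_nonneg hp _ _)) _)) hlt
  have hlt2 : (2 : ℝ) ^ (τ + R) / q < 1 := by
    rw [div_lt_one hq]
    calc (2 : ℝ) ^ (τ + R) < (2 : ℝ) ^ Real.logb 2 q :=
          Real.rpow_lt_rpow_of_exponent_lt (by norm_num) (by linarith)
      _ = q := h2log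
  have t2 := (tendsto_pow_atTop_nhds_zero_of_lt_one (by positivity) hlt2).const_mul ((q : ℝ) ^ 2)
  simpa using t1.add t2

/-- Nonnegativity of conditional entropy. It guarantees that the message length `k` fits into the
block length. -/
lemma mutualInfo_sub_D_le_logb (P : X₁ → X₂ → PMF Y) (V₁ : ZMod q → PMF X₁)
    (V₂ : ZMod q → PMF X₂) : mutualInfo (PWY q V₁ V₂ P) - D q ≤ Real.logb 2 q := by
  have hp := PUUY_nonneg (q := q) V₁ V₂ P
  rw [mutualInfo_sub_D, ← sum_mul_neg_logb_condPMF hp, sub_le_self_iff]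
  refine Finset.sum_nonneg fun u₁ _ => Finset.sum_nonneg fun u₂ _ => Finset.sum_nonneg fun y _ =>
    mul_nonneg (hp _ _ _) (neg_nonneg.mpr (Real.logb_nonpos (by norm_num)
      (condPMF_nonneg hp _ _) (div_le_one_of_le₀ ?_ ?_)))
  · exact Finset.single_le_sum (f := fun w => sumPMF (PUUY q V₁ V₂ P) w y)
      (fun _ _ => sumPMF_nonneg hp _ y) (Finset.mem_univ _)
  · exact Finset.sum_nonneg fun _ _ => sumPMF_nonneg hp _ y

/-- Linearity is not needed here, so both message sets are embedded arbitrarily into vectors of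
length `⌈nR / log q⌉`, with `R` the larger rate. -/
lemma isAchievable_of_lt (P : X₁ → X₂ → PMF Y) (V₁ : ZMod q → PMF X₁) (V₂ : ZMod q → PMF X₂)
    {R₁ R₂ : ℝ} (h0 : 0 ≤ max R₁ R₂) (hR : max R₁ R₂ < mutualInfo (PWY q V₁ V₂ P) - D q) :
    IsAchievable q P R₁ R₂ := by
  have hq1 : (1 : ℝ) < q := by exact_mod_cast (Fact.out : q.Prime).one_lt
  have hq : (0 : ℝ) < q := zero_lt_one.trans hq1
  have hlog : 0 < Real.logb 2 q := Real.logb_pos (by norm_num) hq1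
  have h2log : (2 : ℝ) ^ Real.logb 2 q = q := Real.rpow_logb (by norm_num) (by norm_num) hq
  set R := max R₁ R₂ with hRdef
  have hRq := hR.le.trans (mutualInfo_sub_D_le_logb P V₁ V₂)
  have hne : ∀ (r : ℝ) (n : ℕ), Nonempty (Fin ⌈(2 : ℝ) ^ (n * r)⌉₊) := fun r n =>
    ⟨⟨0, Nat.ceil_pos.mpr (by positivity)⟩⟩
  have hι : ∀ r ≤ R, ∀ n : ℕ, ∃ ι : Fin ⌈(2 : ℝ) ^ (n * r)⌉₊ →
      Fin ⌈n * R / Real.logb 2 q⌉₊ → ZMod q, Function.Injective ι := by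
    intro r hr n
    have hcard : Fintype.card (Fin ⌈(2 : ℝ) ^ (n * r)⌉₊) ≤
        Fintype.card (Fin ⌈n * R / Real.logb 2 q⌉₊ → ZMod q) := by
      simp only [Fintype.card_fin, Fintype.card_fun, ZMod.card]
      rw [Nat.ceil_le, Nat.cast_pow, ← Real.rpow_natCast]
      calc (2 : ℝ) ^ (n * r) ≤ (2 : ℝ) ^ (Real.logb 2 q * (n * R / Real.logb 2 q)) := by
            refine Real.rpow_le_rpow_of_exponent_le (by norm_num) ?_
            rw [mul_div_cancel₀ _ hlog.ne']
            gcongr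
        _ = (q : ℝ) ^ (n * R / Real.logb 2 q) := by rw [Real.rpow_mul (by norm_num), h2log]
        _ ≤ _ := Real.rpow_le_rpow_of_exponent_le hq1.le (Nat.le_ceil _)
    obtain ⟨e⟩ := Function.Embedding.nonempty_of_card_le hcard
    exact ⟨e, e.injective⟩
  choose ι₁ h₁ using hι R₁ (le_max_left _ _)
  choose ι₂ h₂ using hι R₂ (le_max_right _ _)
  obtain ⟨c, -, hc⟩ := exists_codes_tendsto P V₁ V₂ hR
    (k := fun n => ⌈n * R / Real.logb 2 q⌉₊)
    (fun n => Nat.ceil_le.mpr ((div_le_iff₀ hlog).mpr (by gcongr)))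
    (fun n => (Nat.ceil_lt_add_one (by positivity)).le) h₁ h₂
  exact ⟨c, hc⟩

lemma isAchievableByNestedLinear_of_lt (P : X₁ → X₂ → PMF Y) (V₁ : ZMod q → PMF X₁)
    (V₂ : ZMod q → PMF X₂) {R₁ R₂ : ℝ} (h0 : 0 ≤ max R₁ R₂)
    (hR : max R₁ R₂ < mutualInfo (PWY q V₁ V₂ P) - D q) :
    IsAchievableByNestedLinear q P R₁ R₂ := by
  have hq1 : (1 : ℝ) < q := by exact_mod_cast (Fact.out : q.Prime).one_lt
  have hlog : 0 < Real.logb 2 q := Real.logb_pos (by norm_num) hq1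
  have hRq := hR.le.trans (mutualInfo_sub_D_le_logb P V₁ V₂)
  set k := fun n : ℕ => max ⌊n * R₁ / Real.logb 2 q⌋₊ ⌊n * R₂ / Real.logb 2 q⌋₊ with hkdef
  have hkR : ∀ n, (k n : ℝ) ≤ n * max R₁ R₂ / Real.logb 2 q := by
    intro n
    refine le_trans (Nat.cast_le.mpr (max_le (Nat.floor_mono ?_) (Nat.floor_mono ?_)))
      (Nat.floor_le (by positivity))
    · gcongr; exact le_max_left _ _
    · gcongr; exact le_max_right _ _
  have hkn : ∀ n, k n ≤ n := fun n => by
    have h : (k n : ℝ) ≤ n := (hkR n).trans ((div_le_iff₀ hlog).mpr (by gcongr))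
    exact_mod_cast h
  obtain ⟨c, hlin, hc⟩ := exists_codes_tendsto P V₁ V₂ hR hkn
    (fun n => (hkR n).trans (by linarith))
    (M := fun n => Fin ⌊n * R₁ / Real.logb 2 q⌋₊ → ZMod q)
    (N := fun n => Fin ⌊n * R₂ / Real.logb 2 q⌋₊ → ZMod q)
    (fun n => zeroPad_injective (le_max_left _ _)) (fun n => zeroPad_injective (le_max_right _ _))
  refine ⟨c, fun n => ?_, hc⟩
  obtain ⟨d₁, d₂, ht, hv⟩ := hlin n
  refine ⟨padMatrix q n _, d₁, d₂, ?_, fun m => ?_, fun m => ?_⟩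
  · simp only [Function.Injective, padMatrix_mulVec]
    exact fun _ _ h => zeroPad_injective (hkn n) h
  · rw [padMatrix_mulVec]; exact ht m
  · rw [padMatrix_mulVec]; exact hv m

omit [Fintype X₁] [Fintype X₂] in
-- With both rates negative each user has a single message, and the sum is known without using the
-- channel.
lemma isAchievable_of_neg (P : X₁ → X₂ → PMF Y) (x₁ : X₁) (x₂ : X₂) {R₁ R₂ : ℝ}
    (h : max R₁ R₂ < 0) : IsAchievable q P R₁ R₂ ∧ IsAchievableByNestedLinear q P R₁ R₂ := by
  have hlog : 0 ≤ Real.logb 2 q :=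
    Real.logb_nonneg (by norm_num) (by exact_mod_cast (Fact.out : q.Prime).one_lt.le)
  have hfloor : ∀ r ≤ max R₁ R₂, ∀ n : ℕ, ⌊n * r / Real.logb 2 q⌋₊ = 0 := fun r hr n =>
    Nat.floor_of_nonpos (div_nonpos_of_nonpos_of_nonneg
      (mul_nonpos_of_nonneg_of_nonpos n.cast_nonneg (hr.trans h.le)) hlog)
  have hs : ∀ r ≤ max R₁ R₂, ∀ n : ℕ, Subsingleton (Fin ⌈(2 : ℝ) ^ (n * r)⌉₊) := fun r hr n => by
    rw [Fin.subsingleton_iff_le_one, Nat.ceil_le, Nat.cast_one]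
    exact Real.rpow_le_one_of_one_le_of_nonpos (by norm_num)
      (mul_nonpos_of_nonneg_of_nonpos n.cast_nonneg (hr.trans h.le))
  have hs' : ∀ r ≤ max R₁ R₂, ∀ n : ℕ, Subsingleton (Fin ⌊n * r / Real.logb 2 q⌋₊ → ZMod q) :=
    fun r hr n => by rw [hfloor r hr n]; infer_instance
  have i₁ := hs R₁ (le_max_left _ _)
  have i₂ := hs R₂ (le_max_right _ _)
  have j₁ := hs' R₁ (le_max_left _ _)
  have j₂ := hs' R₂ (le_max_right _ _)
  refine ⟨⟨fun n => zeroCode x₁ x₂ n, ?_⟩, ⟨fun n => zeroCode x₁ x₂ n, fun n =>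
    zeroCode_isNestedLinear (hfloor _ (le_max_left _ _) n) (hfloor _ (le_max_right _ _) n) _ _,
    ?_⟩⟩ <;> simp [zeroCode_avgError]

end Achievability

end SumMAC

theorem theorem4 (q : ℕ) [Fact q.Prime]
    {X₁ X₂ Y : Type*} [Fintype X₁] [Fintype X₂] [Fintype Y]
    (P : X₁ → X₂ → PMF Y) (V₁ : ZMod q → PMF X₁) (V₂ : ZMod q → PMF X₂) (R₁ R₂ : ℝ)
    (hR : max R₁ R₂ < SumMAC.mutualInfo (SumMAC.PWY q V₁ V₂ P) - SumMAC.D q) :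
    SumMAC.IsAchievable q P R₁ R₂ ∧ SumMAC.IsAchievableByNestedLinear q P R₁ R₂ := by
  rcases lt_or_ge (max R₁ R₂) 0 with h | h
  -- The test channels serve here only to show that the input alphabets are nonempty.
  · exact SumMAC.isAchievable_of_neg P (V₁ 0).support_nonempty.some (V₂ 0).support_nonempty.some h
  · exact ⟨SumMAC.isAchievable_of_lt P V₁ V₂ h hR,
      SumMAC.isAchievableByNestedLinear_of_lt P V₁ V₂ h hR⟩
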